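/- Let $g,r,d$ be positive integers and set \[A=2r+1+g-d,\qquad B=\binom{r+2}{2},\qquad N=\binom{r+2}{2}-(2d-g).\] Write $(a)_k=a(a-1)\cdots(a-k+1)$ for the falling factorial. For a partition $\lambda=(\lambda_1\ge\lambda_2\ge\cdots)$ let $f^\lambda$ be the number of standard Young tableaux of shape $\lambda$, let $(A\upharpoonright\lambda)=\prod_{(i,j)\in\lambda}(A+j-i)$, the product being over the boxes of $\lambda$ (row $i$, column $j$), and let $F_\lambda(r)=s^*_\lambda(\epsilon(r))$ be the value of the shifted Schur function at the staircase partition $\epsilon(r)=(r+1,r,\dots,1)$. Here, for any $n\ge\ell(\lambda)$, \[s^*_\lambda(x_1,\dots,x_n)=\frac{\det\big((x_i+n-i)_{\lambda_{n+1-j}+j-1}\big)_{1\le i,j\le n}}{\det\big((x_i+n-i)_{j-1}\big)_{1\le i,j\le n}},\] and $\epsilon(r)$ is padded with zeros if $n>r+1$; we evaluate with $n=\max(r+1,\ell(\lambda))$. For $0\le m\le N$ put \[F_{g,r,d}(m)=\frac{2^{2N-m}}{(N-m)!\,m!}\sum_{\lambda\vdash m}\frac{F_\lambda(r)\,f^\lambda}{(A\upharpoonright\lambda)}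 .\] Then, for each $m\in\{0,\dots,7\}$ with $m\le N$ and $m\le|A|$ (the latter says exactly that the denominators displayed below are nonzero), one has: \begin{enumerate} \item $F_{g,r,d}(0)=\frac{2^{2N}}{N!}$; \item $F_{g,r,d}(1)=\frac{2^{2N-1}B}{A(N-1)!\,1!}$; \item $F_{g,r,d}(2)=\frac{2^{2N-2}(B)_2A}{(A+1)_3(N-2)!\,2!}$; \item $F_{g,r,d}(3)=\frac{2^{2N-3}}{(A+2)_5(N-3)!\,3!}\big[(B)_3(A^2-2)-2(B)_2\big]$; \item $F_{g,r,d}(4)=\frac{2^{2N-4}}{A(A+3)_7(N-4)!\,4!}\big[(B)_4(A^2-1)(A^2-9)+(B)_2(B-3)(B-6)(2A^2-3)\big]$; \item $F_{g,r,d}(5)=\frac{2^{2N-5}}{(A+4)_9(N-5)!\,5!}\,B(B-1)(B-3)\big[72+A^4(B-4)(B-2)-20A^2(B-4)(B-1)+6B(13B-48)\big]$; \item $F_{g,r,d}(6)=\frac{2^{2N-6}}{(A+5)_{11}(A+1)_3(N-6)!\,6!}\,B(B-1)(B-3)\big[(B^3-11B^2+38B-40)A^8-(41B^3-411B^2+1198B-840)A^6+2(229B^3-2009B^2+4636B-1680)A^4-2(629B^3-4629B^2+8256B-1280)A^2+240B^3-1440B^2+4800B\big]$;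 \item $F_{g,r,d}(7)=\frac{2^{2N-7}}{(A+6)_{13}(A^2-1)(N-7)!\,7!}\,B(B-1)(B-3)(B-6)\big[(B^3-11B^2+38B-40)A^8-(71B^3-711B^2+2068B-1440)A^6+14(112B^3-977B^2+2233B-840)A^4-2(5699B^3-40149B^2+67266B-9680)A^2+15780B^3-73200B^2+105300B-9000\big]$. \end{enumerate} -/

import Mathlib

open scoped Nat

/-- The falling factorial `(a)_k = a (a - 1) ⋯ (a - k + 1)`. -/
noncomputable def fallingFac (a : ℚ) (k : ℕ) : ℚ :=
  (descPochhammer ℚ k).eval a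

/-- The Young diagram of a partition `p` of `m`. -/
def partitionDiagram {m : ℕ} (p : m.Partition) : YoungDiagram :=
  YoungDiagram.ofRowLens (p.parts.sort (· ≥ ·)) (Multiset.pairwise_sort p.parts (· ≥ ·)).sortedGE

/-- The number `f^μ` of standard Young tableaux of shape `μ`: fillings of the cells of `μ` with
`0, …, |μ| - 1`, each used once, that increase strictly along rows and columns. -/
noncomputable def numStandardTableaux (μ : YoungDiagram) : ℕ :=
  Nat.card {T : μ.cells ≃ Fin μ.card // StrictMono T}

/-- The generalized raising factorial `(a ↾ μ) = ∏ (a + j - i)` over the cells `(i, j)` of `μ`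
(the difference `j - i` does not depend on whether rows and columns are counted from 0 or 1). -/
def raisingFac (a : ℚ) (μ : YoungDiagram) : ℚ :=
  ∏ c ∈ μ.cells, (a + (c.2 : ℚ) - (c.1 : ℚ))

/-- For a partition `μ` with at most `n` rows, the value at `x = (x_1, …, x_n)` of the shifted Schur
polynomial `s*_μ(x_1, …, x_n) = det((x_i + n - i)_{i_j}) / det((x_i + n - i)_{j - 1})`, where
`i_j = μ_{n + 1 - j} + j - 1`. Indices are counted from 0 in the code. The quotient of the two values
is the value of the polynomial as soon as the denominator is nonzero, that is, the numbers `x_i - i`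
are distinct; this holds for all weakly decreasing `x`. -/
noncomputable def shiftedSchur {n : ℕ} (μ : YoungDiagram) (x : Fin n → ℚ) : ℚ :=
  (Matrix.of fun i j : Fin n =>
      fallingFac (x i + n - 1 - (i : ℕ)) (μ.rowLen (Fin.rev j) + (j : ℕ))).det /
    (Matrix.of fun i j : Fin n => fallingFac (x i + n - 1 - (i : ℕ)) (j : ℕ)).det

/-- The staircase partition `ε(r) = (r + 1, r, …, 1)`, padded with zeros or cut to `n` entries. -/
def staircase (r n : ℕ) : Fin n → ℚ :=
  fun i => ((r + 1 - (i : ℕ) : ℕ) : ℚ)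

/-- The value `F_μ(r) = s*_μ(ε(r))` of the shifted Schur function, computed in enough variables to
accommodate both `μ` (with `μ.colLen 0` rows) and `ε(r)` (with `r + 1` rows). -/
noncomputable def shiftedSchurStaircase (μ : YoungDiagram) (r : ℕ) : ℚ :=
  shiftedSchur μ (staircase r (max (r + 1) (μ.colLen 0)))

/-- `A = 2r + 1 + g - d`. -/
def smrcA (g r d : ℕ) : ℤ := 2 * r + 1 + g - d

/-- `N = C(r + 2, 2) - (2d - g)`. -/
def smrcN (g r d : ℕ) : ℤ := ((r + 2).choose 2 : ℤ) - (2 * d - g)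

/-- `F_{g,r,d}(m) = 2^(2N - m) / ((N - m)! m!) · ∑_{λ ⊢ m} F_λ(r) f^λ / (A ↾ λ)`, for `m ≤ N`. -/
noncomputable def smrcF (g r d m : ℕ) : ℚ :=
  (2 : ℚ) ^ (2 * smrcN g r d - m) / (((smrcN g r d - m).toNat ! : ℚ) * (m ! : ℚ)) *
    ∑ p : m.Partition,
      shiftedSchurStaircase (partitionDiagram p) r *
        (numStandardTableaux (partitionDiagram p) : ℚ) /
          raisingFac (smrcA g r d) (partitionDiagram p)

/-!
The sum over `λ ⊢ m` has at most 15 terms, so the point is to evaluate each term for all `r` and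
`A`.

*The values `F_λ(r)`.* With `n = r + 1` variables, the numbers `x_i + n - i` for the staircase are
the odd numbers `2k + 1`, `0 ≤ k < n`. Since `(1 + t)^(2k + 1) = (1 + t) (1 + t (2 + t))^k`, the
falling factorial `(2k + 1)_l` is a combination of the binomial coefficients `C(k, s)` with
coefficients `l! [t^(l - s)] (1 + t) (2 + t)^s` (`fallingFac_odd_eq_sum`). So both determinants in
the definition of `s*_λ` contain the determinant of the matrix `C(k, s)` as a factor
(`exists_det_fallingFac_odd_eq`). What remains is block triangular, with a block of size `ℓ(λ)`
that depends on `λ`, and after taking factorials and powers of 2 out of its columns and rows one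
gets (`shiftedSchurStaircase_eq`)

  `F_λ(r) = (n ↾ λ) · det (h_{n - 1 - b}(λ_a - a + b))`, `0 ≤ a, b < ℓ(λ)`,

where `h_x(m) = C(x, m) / 2^m + C(x, m - 1) / 2^(m - 1)`. This also holds for `ℓ(λ) > n`, where
both sides are zero. For a fixed `λ` the right side is a polynomial in `n`. For all `λ` of size at
most 7 it turns out to be a polynomial in `B = n (n + 1) / 2`.

*The numbers `f^λ` and the index set.* A standard tableau is a linear extension of the poset of
cells. Linear extensions and partitions are listed by recursive functions that can be evaluated
(`card_strictMono_equiv_eq_length_linearExtensions`, `sum_partition_eq_sum_partitionLists`).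

*The sum.* The contents `j - i` of the cells of a partition of `m` are less than `m` in absolute
value, so for `m ≤ |A|` all denominators are nonzero. Clearing them leaves an identity of
polynomials in `A` and `B`.
-/

/-! ### Enumeration of partitions -/

/-- The weakly decreasing lists of positive integers with sum `m` and all entries at most `k`. The
first argument is a recursion bound; it does not matter as long as it is at least `m`. -/
def partitionLists : ℕ → ℕ → ℕ → List (List ℕ)
  | 0, _, m => if m = 0 then [[]] else []
  | f + 1, k, m =>
    if m = 0 then [[]]
    else (List.range k).flatMap fun a =>
      if a + 1 ≤ m then (partitionLists f (a + 1) (m - (a + 1))).map (List.cons (a + 1)) else []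

theorem mem_partitionLists {f : ℕ} : ∀ {k m : ℕ}, m ≤ f → ∀ {l : List ℕ},
    l ∈ partitionLists f k m ↔ l.Pairwise (· ≥ ·) ∧ (∀ x ∈ l, 0 < x ∧ x ≤ k) ∧ l.sum = m := by
  have base : ∀ {k : ℕ} {l : List ℕ}, l ∈ [([] : List ℕ)] ↔
      l.Pairwise (· ≥ ·) ∧ (∀ x ∈ l, 0 < x ∧ x ≤ k) ∧ l.sum = 0 := by
    intro k l
    cases l with
    | nil => simp
    | cons a l =>
      refine iff_of_false (by simp) ?_
      rintro ⟨-, h, h'⟩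
      have := h a (by simp)
      rw [List.sum_cons] at h'
      omega
  induction f with
  | zero =>
    intro k m hm l
    obtain rfl : m = 0 := by omega
    exact base
  | succ f ih =>
    intro k m hm l
    rcases Nat.eq_zero_or_pos m with rfl | hpos
    · simpa [partitionLists] using base (k := k) (l := l)
    · simp only [partitionLists, hpos.ne', if_false, List.mem_flatMap, List.mem_range]
      cases l with
      | nil =>
        simp only [List.sum_nil, hpos.ne, and_false, iff_false, not_exists, not_and]
        intro a _
        split_ifs <;> simp
      | cons b l =>
        constructor
        · rintro ⟨a, hak, h⟩
          split_ifs at h with ham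
          · obtain ⟨l', hl', h'⟩ := List.mem_map.1 h
            obtain ⟨rfl, rfl⟩ := List.cons.inj h'
            obtain ⟨h1, h2, h3⟩ := (ih (by omega)).1 hl'
            refine ⟨List.pairwise_cons.2 ⟨fun x hx => (h2 x hx).2, h1⟩, ?_, ?_⟩
            · intro x hx
              rcases List.mem_cons.1 hx with rfl | hx
              · omega
              · have := h2 x hx
                omega
            · rw [List.sum_cons]; omega
          · simp at h
        · rintro ⟨h1, h2, h3⟩
          have hb := h2 b (by simp)
          rw [List.sum_cons] at h3
          rw [List.pairwise_cons] at h1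
          refine ⟨b - 1, by omega, ?_⟩
          rw [if_pos (by omega), Nat.sub_add_cancel hb.1]
          refine List.mem_map.2 ⟨l, (ih (by omega)).2 ⟨h1.2, fun x hx => ?_, by omega⟩, rfl⟩
          exact ⟨(h2 x (by simp [hx])).1, h1.1 x hx⟩

theorem nodup_partitionLists (f k m : ℕ) : (partitionLists f k m).Nodup := by
  induction f generalizing k m with
  | zero => unfold partitionLists; split_ifs <;> simp
  | succ f ih =>
    unfold partitionLists
    split_ifs
    · simp
    · refine List.nodup_flatMap.2 ⟨fun a _ => ?_, List.nodup_range.imp fun {a b} hab => ?_⟩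
      · split_ifs
        · exact (ih _ _).map List.cons_injective
        · simp
      · intro l ha hb
        dsimp only at ha hb
        split_ifs at ha hb
        · obtain ⟨_, _, rfl⟩ := List.mem_map.1 ha
          obtain ⟨_, _, h⟩ := List.mem_map.1 hb
          have := (List.cons.inj h).1
          omega
        all_goals simp_all

theorem sum_partition_eq_sum_partitionLists (m : ℕ) (G : List ℕ → ℚ) :
    ∑ p : m.Partition, G (p.parts.sort (· ≥ ·)) = ((partitionLists m m m).map G).sum := by
  rw [← List.sum_toFinset _ (nodup_partitionLists m m m)]
  refine Finset.sum_bij (fun p _ => p.parts.sort (· ≥ ·)) ?_ ?_ ?_ (fun _ _ => rfl)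
  · intro p _
    rw [List.mem_toFinset, mem_partitionLists le_rfl]
    refine ⟨Multiset.pairwise_sort _ _, fun x hx => ?_, ?_⟩
    · rw [Multiset.mem_sort] at hx
      exact ⟨p.parts_pos hx, p.le_of_mem_parts hx⟩
    · rw [← Multiset.sum_coe, Multiset.sort_eq, p.parts_sum]
  · intro p _ q _ h
    ext1
    rw [← Multiset.sort_eq p.parts (· ≥ ·), ← Multiset.sort_eq q.parts (· ≥ ·)]
    exact congrArg _ h
  · intro l hl
    rw [List.mem_toFinset, mem_partitionLists le_rfl] at hl
    obtain ⟨h1, h2, h3⟩ := hl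
    refine ⟨⟨l, fun {i} hi => (h2 i hi).1, by simpa using h3⟩, Finset.mem_univ _, ?_⟩
    rw [Multiset.coe_sort]
    exact List.mergeSort_eq_self _ (by simpa using h1)

/-! ### Standard Young tableaux as linear extensions -/

section LinearExtensions

variable {α : Type*} [DecidableEq α] [PartialOrder α] [DecidableLE α]

/-- The orderings of a list `s` of length `k` in which no entry is followed by a smaller one: a
minimal entry comes first, followed by such an ordering of the others. -/
def linearExtensions : ℕ → List α → List (List α)
  | 0, _ => [[]]
  | k + 1, s => s.flatMap fun c =>
      if ∀ b ∈ s, b ≤ c → b = c then (linearExtensions k (s.erase c)).map (List.cons c) else []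

theorem mem_linearExtensions {k : ℕ} : ∀ {s : List α}, s.Nodup → s.length = k → ∀ {l : List α},
    l ∈ linearExtensions k s ↔ l.Pairwise (fun a b => ¬ b ≤ a) ∧ l.Perm s := by
  induction k with
  | zero =>
    intro s _ hs l
    rw [List.length_eq_zero_iff] at hs
    subst hs
    simp only [linearExtensions, List.mem_singleton, List.perm_nil]
    exact ⟨fun h => ⟨h ▸ List.Pairwise.nil, h⟩, fun h => h.2⟩
  | succ k ih =>
    intro s hnd hs l
    simp only [linearExtensions, List.mem_flatMap]
    have hlen : ∀ c ∈ s, (s.erase c).length = k := fun c hc => by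
      rw [List.length_erase_of_mem hc, hs, Nat.add_sub_cancel]
    constructor
    · rintro ⟨c, hc, h⟩
      split_ifs at h with hmin
      · obtain ⟨l', hl', rfl⟩ := List.mem_map.1 h
        obtain ⟨h1, h2⟩ := (ih (hnd.erase c) (hlen c hc)).1 hl'
        refine ⟨List.pairwise_cons.2 ⟨fun b hb hbc => ?_, h1⟩,
          List.cons_perm_iff_perm_erase.2 ⟨hc, h2⟩⟩
        have hb' := hnd.mem_erase_iff.1 (h2.subset hb)
        exact hb'.1 (hmin b hb'.2 hbc)
      · simp at h
    · rintro ⟨h1, h2⟩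
      cases l with
      | nil => simp [← h2.length_eq] at hs
      | cons c l =>
        obtain ⟨hc, h3⟩ := List.cons_perm_iff_perm_erase.1 h2
        rw [List.pairwise_cons] at h1
        refine ⟨c, hc, ?_⟩
        rw [if_pos]
        · exact List.mem_map.2 ⟨l, (ih (hnd.erase c) (hlen c hc)).2 ⟨h1.2, h3⟩, rfl⟩
        · intro b hb hbc
          rcases List.mem_cons.1 (h2.symm.subset hb) with h | h
          · exact h
          · exact absurd hbc (h1.1 b h)

theorem nodup_linearExtensions (k : ℕ) {s : List α} (hs : s.Nodup) :
    (linearExtensions k s).Nodup := by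
  induction k generalizing s with
  | zero => simp [linearExtensions]
  | succ k ih =>
    refine List.nodup_flatMap.2 ⟨fun c _ => ?_, hs.imp fun {a b} hab => ?_⟩
    · split_ifs
      · exact (ih (hs.erase c)).map List.cons_injective
      · simp
    · intro l ha hb
      dsimp only at ha hb
      split_ifs at ha hb
      · obtain ⟨_, _, rfl⟩ := List.mem_map.1 ha
        obtain ⟨_, _, h⟩ := List.mem_map.1 hb
        exact hab (List.cons.inj h).1.symm
      all_goals simp_all

/-- A strictly monotone numbering of `S` is the same as an ordering of `S` in which no element is
followed by a smaller one: list the elements by their numbers. -/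
theorem card_strictMono_equiv_eq_length_linearExtensions {s : List α} (hs : s.Nodup) {S : Finset α}
    (hS : s.toFinset = S) :
    Nat.card {T : S ≃ Fin S.card // StrictMono T} = (linearExtensions s.length s).length := by
  have hmem : ∀ x, x ∈ s ↔ x ∈ S := fun x => by rw [← hS, List.mem_toFinset]
  have hcard : s.length = S.card := by rw [← hS, List.toFinset_card_of_nodup hs]
  rw [← List.toFinset_card_of_nodup (nodup_linearExtensions s.length hs)]
  have key : ∀ T : {T : S ≃ Fin S.card // StrictMono T},
      List.ofFn (fun i => (T.1.symm i : α)) ∈ linearExtensions s.length s := by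
    rintro ⟨T, hT⟩
    rw [mem_linearExtensions hs rfl]
    constructor
    · rw [List.pairwise_ofFn]
      intro i j hij h
      have : T (T.symm j) ≤ T (T.symm i) := hT.monotone h
      simp only [Equiv.apply_symm_apply] at this
      exact absurd hij this.not_gt
    · have hnd : (List.ofFn fun i => (T.symm i : α)).Nodup :=
        List.nodup_ofFn.2 (Subtype.val_injective.comp T.symm.injective)
      rw [List.perm_ext_iff_of_nodup hnd hs]
      intro x
      rw [List.mem_ofFn, hmem]
      exact ⟨fun ⟨i, hi⟩ => hi ▸ (T.symm i).2, fun hx => ⟨T ⟨x, hx⟩, by simp⟩⟩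
  refine (Nat.card_eq_of_bijective
    (fun T => (⟨List.ofFn (fun i => (T.1.symm i : α)), List.mem_toFinset.2 (key T)⟩ :
      ((linearExtensions s.length s).toFinset : Finset (List α)))) ⟨?_, ?_⟩).trans
    (Nat.card_eq_finsetCard _)
  · intro T U h
    have h' := List.ofFn_injective (Subtype.ext_iff.1 h)
    apply Subtype.ext
    apply Equiv.symm_bijective.1
    ext i
    exact congrFun h' i
  · rintro ⟨l, hl⟩
    rw [List.mem_toFinset, mem_linearExtensions hs rfl] at hl
    obtain ⟨h1, h2⟩ := hl
    have hlen : l.length = S.card := h2.length_eq.trans hcard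
    have hnd : l.Nodup := h2.nodup_iff.2 hs
    let g : Fin S.card → S := fun i =>
      ⟨l.get (i.cast hlen.symm), (hmem _).1 (h2.subset (l.get_mem _))⟩
    have hg : Function.Bijective g := by
      rw [Fintype.bijective_iff_injective_and_card]
      refine ⟨fun i j hij => ?_, by simp⟩
      exact Fin.cast_injective _ (List.nodup_iff_injective_get.1 hnd (Subtype.ext_iff.1 hij))
    refine ⟨⟨(Equiv.ofBijective g hg).symm, fun x y hxy => ?_⟩, ?_⟩
    · obtain ⟨i, rfl⟩ := hg.2 x
      obtain ⟨j, rfl⟩ := hg.2 y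
      rw [Equiv.ofBijective_symm_apply_apply, Equiv.ofBijective_symm_apply_apply]
      by_contra hij
      rcases (not_lt.1 hij).eq_or_lt with rfl | hji
      · exact lt_irrefl _ hxy
      · exact List.pairwise_iff_get.1 h1 (j.cast hlen.symm) (i.cast hlen.symm) hji hxy.le
    · apply Subtype.ext
      apply List.ext_get (by simp [hlen])
      intro n _ _
      simp [g]

end LinearExtensions

/-- The cells `(i, j)`, counted from 0, of the Young diagram with row lengths `w`. -/
def cellList (w : List ℕ) : List (ℕ × ℕ) :=
  (List.range w.length).flatMap fun i => (List.range (w.getD i 0)).map (Prod.mk i)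

theorem nodup_cellList (w : List ℕ) : (cellList w).Nodup := by
  refine List.nodup_flatMap.2 ⟨fun i _ => List.nodup_range.map (Prod.mk_right_injective i),
    List.nodup_range.imp fun {a b} hab => ?_⟩
  intro c ha hb
  obtain ⟨_, _, rfl⟩ := List.mem_map.1 ha
  obtain ⟨_, _, h⟩ := List.mem_map.1 hb
  exact hab (Prod.ext_iff.1 h).1.symm

theorem toFinset_cellList {w : List ℕ} (hw : w.SortedGE) :
    (cellList w).toFinset = (YoungDiagram.ofRowLens w hw).cells := by
  ext ⟨i, j⟩
  rw [YoungDiagram.mem_cells, YoungDiagram.mem_ofRowLens, List.mem_toFinset]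
  simp only [cellList, List.mem_flatMap, List.mem_range, List.mem_map, Prod.mk.injEq]
  constructor
  · rintro ⟨a, ha, b, hb, rfl, rfl⟩
    exact ⟨ha, by rwa [List.getD_eq_getElem _ _ ha] at hb⟩
  · rintro ⟨ha, hb⟩
    exact ⟨i, ha, j, by rwa [List.getD_eq_getElem _ _ ha], rfl, rfl⟩

/-- The number of standard Young tableaux of shape `w`, in a form that the kernel can evaluate. -/
def standardTableauxCount (w : List ℕ) : ℕ :=
  (linearExtensions (cellList w).length (cellList w)).length

theorem numStandardTableaux_ofRowLens {w : List ℕ} (hw : w.SortedGE) :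
    numStandardTableaux (YoungDiagram.ofRowLens w hw) = standardTableauxCount w :=
  card_strictMono_equiv_eq_length_linearExtensions (nodup_cellList w) (toFinset_cellList hw)

/-- The product of `a + c` over the contents `c = j - i` of the cells `(i, j)` of the diagram with
row lengths `w`. The contents are integers so that they evaluate to literals. -/
def contentProd (a : ℚ) (w : List ℕ) : ℚ :=
  ((cellList w).map fun c => a + (((c.2 : ℤ) - (c.1 : ℤ) : ℤ) : ℚ)).prod

theorem raisingFac_ofRowLens (a : ℚ) {w : List ℕ} (hw : w.SortedGE) :
    raisingFac a (YoungDiagram.ofRowLens w hw) = contentProd a w := by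
  rw [raisingFac, contentProd, ← toFinset_cellList hw, List.prod_toFinset _ (nodup_cellList w)]
  simp only [Int.cast_sub, Int.cast_natCast, add_sub_assoc]

/-! ### A determinant formula for shifted Schur functions at a staircase -/

open Polynomial in
/-- The number `l! [t^(l - s)] (1 + t) (2 + t)^s`, the coefficient of `C(k, s)` in the expansion
of the falling factorial `(2k + 1)_l`. -/
noncomputable def oddNodeCoeff (l s : ℕ) : ℚ :=
  (l ! : ℚ) * (((1 + X) * (X + C 2) ^ s * X ^ s : ℚ[X]).coeff l)

/-- `C(x, m) / 2^m + C(x, m - 1) / 2^(m - 1)`: for a natural number `x`, the coefficient of `t^m` in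
`(1 + t) (1 + t / 2)^x`. -/
noncomputable def halfBinomial (x : ℚ) : ℕ → ℚ
  | 0 => 1
  | m + 1 => fallingFac x (m + 1) / ((m + 1)! : ℚ) / 2 ^ (m + 1) +
    fallingFac x m / (m ! : ℚ) / 2 ^ m

/-- `halfBinomial x (l - s)` with the convention that it is `0` at a negative index. -/
noncomputable def staircaseEntry (x : ℚ) (l s : ℕ) : ℚ :=
  if s ≤ l then halfBinomial x (l - s) else 0

/-- The Jacobi–Trudi type determinant with entries `halfBinomial (x - 1 - b) (v_a - (n - 1 - b))`.
For `v_a = μ_a + n - 1 - a` the index is `μ_a - a + b`. -/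
noncomputable def staircaseDet {n : ℕ} (v : Fin n → ℕ) (x : ℚ) : ℚ :=
  (Matrix.of fun a b : Fin n => staircaseEntry (x - 1 - (b : ℕ)) (v a) (n - 1 - b)).det

theorem fallingFac_natCast (n k : ℕ) : fallingFac (n : ℚ) k = (n.descFactorial k : ℚ) :=
  descPochhammer_eval_eq_descFactorial ℚ n k

theorem fallingFac_succ (a : ℚ) (k : ℕ) : fallingFac a (k + 1) = fallingFac a k * (a - k) := by
  simp [fallingFac, descPochhammer_succ_right]

theorem fallingFac_zero (a : ℚ) : fallingFac a 0 = 1 := by simp [fallingFac]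

theorem choose_eq_fallingFac_div (n k : ℕ) :
    (n.choose k : ℚ) = fallingFac (n : ℚ) k / (k ! : ℚ) := by
  rw [fallingFac_natCast, Nat.descFactorial_eq_factorial_mul_choose, Nat.cast_mul,
    mul_div_cancel_left₀ _ (by positivity)]

/-- The generating function of `(2k + 1)_l / l!` is `(1 + t)^(2k + 1)`, and
`(1 + t)^2 = 1 + t (2 + t)`. -/
theorem fallingFac_odd_eq_sum {k n : ℕ} (hk : k < n) (l : ℕ) :
    fallingFac ((2 * k + 1 : ℕ) : ℚ) l =
      ∑ s ∈ Finset.range n, (k.choose s : ℚ) * oddNodeCoeff l s := by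
  have hpoly : ((1 + Polynomial.X) ^ (2 * k + 1) : Polynomial ℚ) =
      ∑ s ∈ Finset.range (k + 1), Polynomial.C (k.choose s : ℚ) *
        ((1 + Polynomial.X) * (Polynomial.X + Polynomial.C 2) ^ s * Polynomial.X ^ s) := by
    have h2 : (Polynomial.C 2 : Polynomial ℚ) = 2 := rfl
    have h1 : ((1 + Polynomial.X) ^ 2 : Polynomial ℚ) =
        (Polynomial.X + Polynomial.C 2) * Polynomial.X + 1 := by rw [h2]; ring
    rw [pow_succ, pow_mul, h1, add_pow, Finset.sum_mul]
    refine Finset.sum_congr rfl fun s _ => ?_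
    rw [one_pow, mul_pow, Polynomial.C_eq_natCast]
    ring
  rw [fallingFac_natCast, Nat.descFactorial_eq_factorial_mul_choose, Nat.cast_mul,
    ← Polynomial.coeff_one_add_X_pow ℚ, hpoly, Polynomial.finsetSum_coeff, Finset.mul_sum,
    ← Finset.sum_subset (Finset.range_subset_range.2 hk)]
  · refine Finset.sum_congr rfl fun s _ => ?_
    rw [Polynomial.coeff_C_mul, oddNodeCoeff]
    ring
  · intro s _ hs
    rw [Finset.mem_range, not_lt] at hs
    rw [Nat.choose_eq_zero_of_lt hs, Nat.cast_zero, zero_mul]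

theorem coeff_X_add_two_pow (s m : ℕ) :
    ((Polynomial.X + Polynomial.C 2 : Polynomial ℚ) ^ s).coeff m =
      2 ^ s * (fallingFac (s : ℚ) m / (m ! : ℚ) / 2 ^ m) := by
  rw [Polynomial.coeff_X_add_C_pow, ← choose_eq_fallingFac_div]
  rcases le_or_gt m s with h | h
  · rw [← pow_sub_mul_pow (2 : ℚ) h]
    field_simp
  · simp [Nat.choose_eq_zero_of_lt h]

theorem oddNodeCoeff_eq (l s : ℕ) :
    oddNodeCoeff l s = (l ! : ℚ) * (2 ^ s * staircaseEntry (s : ℚ) l s) := by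
  rw [oddNodeCoeff, staircaseEntry, Polynomial.coeff_mul_X_pow']
  split_ifs
  · congr 1
    rw [add_mul, one_mul, Polynomial.coeff_add, coeff_X_add_two_pow]
    cases l - s with
    | zero => simp [halfBinomial, fallingFac_zero]
    | succ m =>
      rw [Polynomial.coeff_X_mul, coeff_X_add_two_pow, halfBinomial]
      ring
  · simp

theorem staircaseEntry_self (x : ℚ) (s : ℕ) : staircaseEntry x s s = 1 := by
  simp [staircaseEntry, halfBinomial]

theorem staircaseEntry_of_lt (x : ℚ) {l s : ℕ} (h : l < s) : staircaseEntry x l s = 0 :=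
  if_neg h.not_ge

theorem staircaseEntry_add (x : ℚ) (l s k : ℕ) :
    staircaseEntry x (l + k) (s + k) = staircaseEntry x l s := by
  simp [staircaseEntry, Nat.add_sub_add_right]

/-- The matrix of expansion coefficients that remains of the numerator of a shifted Schur function
at a staircase once the nodes are split off. Rows and columns are in decreasing order, and `p`
shifts all indices, so that the blocks of such a matrix have the same form. -/
noncomputable def oddNodeMatrix (n p : ℕ) (v : ℕ → ℕ) : Matrix (Fin n) (Fin n) ℚ :=
  Matrix.of fun b a => oddNodeCoeff (v a + (n - 1 - a + p)) (n - 1 - b + p)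

/-- The numerator at the odd nodes `1, 3, …, 2n - 1` factors as `oddNodeMatrix` times a determinant
`ε` of binomial coefficients which does not depend on the partition. Hence `ε` cancels against the
denominator, which is the case `v = 0`. -/
theorem exists_det_fallingFac_odd_eq (n : ℕ) :
    ∃ ε : ℚ, ε ≠ 0 ∧ ∀ v : ℕ → ℕ,
      (Matrix.of fun i j : Fin n =>
        fallingFac ((2 * (Fin.rev i : ℕ) + 1 : ℕ) : ℚ) (v (Fin.rev j) + (j : ℕ))).det =
      ε * (oddNodeMatrix n 0 v).det := by
  let Q : Matrix (Fin n) (Fin n) ℚ := Matrix.of fun k s => ((k : ℕ).choose (s : ℕ) : ℚ)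
  have hQ : Q.det = 1 := by
    rw [Matrix.det_of_isLowerTriangular]
    · simp [Q]
    · intro i j hij
      have hij' : (i : ℕ) < j := hij
      simp only [Q, Matrix.of_apply]
      rw [Nat.choose_eq_zero_of_lt hij', Nat.cast_zero]
  refine ⟨(Q.submatrix Fin.revPerm id).det, ?_, fun v => ?_⟩
  · rw [Matrix.det_permute, hQ, mul_one]
    exact_mod_cast (Equiv.Perm.sign (Fin.revPerm : Equiv.Perm (Fin n))).ne_zero
  · rw [← Matrix.det_submatrix_equiv_self Fin.revPerm (oddNodeMatrix n 0 v), ← Matrix.det_mul]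
    congr 1
    ext i j
    rw [Matrix.of_apply, fallingFac_odd_eq_sum (Fin.rev i).isLt, Matrix.mul_apply,
      ← Fin.sum_univ_eq_sum_range]
    refine Finset.sum_congr rfl fun s _ => ?_
    simp only [Q, oddNodeMatrix, Matrix.submatrix_apply, Matrix.of_apply, Fin.revPerm_apply, id,
      Fin.val_rev]
    congr 2 <;> omega

/-- Rows of length `0` contribute a triangular block that does not depend on the partition. -/
theorem det_oddNodeMatrix_add (l k : ℕ) {v : ℕ → ℕ} (hv : ∀ i, l ≤ i → v i = 0) :
    (oddNodeMatrix (l + k) 0 v).det =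
      (oddNodeMatrix l k v).det * (oddNodeMatrix k 0 fun _ => 0).det := by
  rw [← Matrix.det_submatrix_equiv_self finSumFinEquiv]
  set M := (oddNodeMatrix (l + k) 0 v).submatrix finSumFinEquiv finSumFinEquiv with hM
  rw [← Matrix.fromBlocks_toBlocks M]
  have h12 : M.toBlocks₁₂ = 0 := by
    ext b a
    simp only [hM, Matrix.toBlocks₁₂, oddNodeMatrix, Matrix.submatrix_apply, Matrix.of_apply,
      finSumFinEquiv_apply_left, finSumFinEquiv_apply_right, Fin.val_castAdd, Fin.val_natAdd,
      Matrix.zero_apply]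
    rw [hv _ (by omega), oddNodeCoeff_eq, staircaseEntry_of_lt _ (by omega)]
    ring
  have h11 : M.toBlocks₁₁ = oddNodeMatrix l k v := by
    ext b a
    simp only [hM, Matrix.toBlocks₁₁, oddNodeMatrix, Matrix.submatrix_apply, Matrix.of_apply,
      finSumFinEquiv_apply_left, Fin.val_castAdd]
    congr 1 <;> omega
  have h22 : M.toBlocks₂₂ = oddNodeMatrix k 0 fun _ => 0 := by
    ext b a
    simp only [hM, Matrix.toBlocks₂₂, oddNodeMatrix, Matrix.submatrix_apply, Matrix.of_apply,
      finSumFinEquiv_apply_right, Fin.val_natAdd]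
    rw [hv _ (by omega)]
    congr 1 <;> omega
  rw [h12, Matrix.det_fromBlocks_zero₁₂, h11, h22]

theorem det_oddNodeMatrix_eq (l p : ℕ) (v : ℕ → ℕ) :
    (oddNodeMatrix l p v).det =
      (∏ a : Fin l, ((v a + (l - 1 - a + p))! : ℚ)) * (∏ b : Fin l, (2 : ℚ) ^ (l - 1 - b + p : ℕ)) *
        staircaseDet (fun a : Fin l => v a + (l - 1 - a)) ((l + p : ℕ) : ℚ) := by
  rw [staircaseDet, ← Matrix.det_transpose (Matrix.of _), mul_assoc, ← Matrix.det_mul_column,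
    ← Matrix.det_mul_row]
  congr 1
  ext b a
  simp only [oddNodeMatrix, Matrix.of_apply, Matrix.transpose_apply, oddNodeCoeff_eq]
  rw [← add_assoc, staircaseEntry_add]
  have : ((l - 1 - b + p : ℕ) : ℚ) = ((l + p : ℕ) : ℚ) - 1 - (b : ℕ) := by
    have : l + p = (l - 1 - b + p) + 1 + b := by omega
    rw [this]
    push_cast
    ring
  rw [this]

/-- The empty partition gives a unitriangular matrix. -/
theorem staircaseDet_zero (l : ℕ) (x : ℚ) :
    staircaseDet (fun a : Fin l => l - 1 - a) x = 1 := by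
  rw [staircaseDet, Matrix.det_of_isUpperTriangular]
  · simp [staircaseEntry_self]
  · intro a b hab
    have : (b : ℕ) < a := hab
    exact staircaseEntry_of_lt _ (by omega)

theorem factorial_mul_prod_range (p v : ℕ) (a x : ℚ) (hx : x - a = p + 1) :
    (p ! : ℚ) * ∏ j ∈ Finset.range v, (x + (j : ℚ) - a) = ((v + p)! : ℚ) := by
  induction v with
  | zero => simp
  | succ v ih =>
    rw [Finset.prod_range_succ, ← mul_assoc, ih, show v + 1 + p = (v + p) + 1 by ring,
      Nat.factorial_succ]
    have : x + v - a = v + p + 1 := by linear_combination hx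
    rw [this]
    push_cast
    ring

theorem raisingFac_eq_prod_range (a : ℚ) (μ : YoungDiagram) {l : ℕ} (hl : μ.colLen 0 = l) :
    raisingFac a μ =
      ∏ i : Fin l, ∏ j ∈ Finset.range (μ.rowLen i), (a + (j : ℚ) - ((i : ℕ) : ℚ)) := by
  rw [Fin.prod_univ_eq_prod_range
    (fun i => ∏ j ∈ Finset.range (μ.rowLen i), (a + (j : ℚ) - (i : ℚ))), raisingFac]
  refine Finset.prod_finset_product _ _ _ fun p => ?_
  rw [YoungDiagram.mem_cells, Finset.mem_range, Finset.mem_range, ← hl,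
    ← YoungDiagram.mem_iff_lt_rowLen, ← YoungDiagram.mem_iff_lt_colLen]
  exact ⟨fun h => ⟨μ.up_left_mem le_rfl (Nat.zero_le _) h, h⟩, fun h => h.2⟩

/-- `F_μ(r) = ((r + 1) ↾ μ) · det (h_{r - b}(μ_a - a + b))`, where `h_x(m)` is `halfBinomial x m`
and the size of the determinant is the number of rows of `μ`. -/
theorem shiftedSchurStaircase_eq (μ : YoungDiagram) (r : ℕ) {l : ℕ} (hl : μ.colLen 0 = l) :
    shiftedSchurStaircase μ r =
      raisingFac (r + 1) μ * staircaseDet (fun a : Fin l => μ.rowLen a + (l - 1 - a)) (r + 1) := by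
  rw [shiftedSchurStaircase, hl]
  rcases le_or_gt l (r + 1) with h | h
  · rw [max_eq_left h]
    obtain ⟨k, hk⟩ := Nat.exists_eq_add_of_le h
    -- The nodes `x_i + n - 1 - i` are the odd numbers `2 (r - i) + 1`.
    have hnode : ∀ v : ℕ → ℕ, (Matrix.of fun i j : Fin (r + 1) =>
        fallingFac (staircase r (r + 1) i + ((r + 1 : ℕ) : ℚ) - 1 - (i : ℕ))
          (v (Fin.rev j) + (j : ℕ))) =
        Matrix.of fun i j : Fin (r + 1) =>
          fallingFac ((2 * (Fin.rev i : ℕ) + 1 : ℕ) : ℚ) (v (Fin.rev j) + (j : ℕ)) := by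
      intro v
      ext i j
      simp only [Matrix.of_apply, staircase, Fin.val_rev]
      congr 1
      have h1 : r + 1 - (i : ℕ) = (r + 1 - (i + 1)) + 1 := by omega
      have h2 : ((r + 1 : ℕ) : ℚ) = ((r + 1 - (i + 1) : ℕ) : ℚ) + (i : ℕ) + 1 := by
        rw [Nat.cast_sub (by omega)]
        push_cast
        ring
      rw [h1, h2]
      push_cast
      ring
    obtain ⟨ε, hε, H⟩ := exists_det_fallingFac_odd_eq (r + 1)
    have h0 := hnode fun _ => 0
    have hμ := hnode μ.rowLen
    have e0 := H fun _ => 0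
    simp only [zero_add] at h0 e0
    have hrow : ∀ i, l ≤ i → μ.rowLen i = 0 := by
      intro i hi
      by_contra hne
      have := YoungDiagram.mem_iff_lt_rowLen.2 (Nat.pos_of_ne_zero hne)
      rw [YoungDiagram.mem_iff_lt_colLen] at this
      omega
    rw [shiftedSchur, h0, hμ, H, e0, hk, det_oddNodeMatrix_add l k hrow,
      det_oddNodeMatrix_add l k fun _ _ => rfl, mul_div_mul_left _ _ hε]
    have hZ : (oddNodeMatrix k 0 fun _ => 0).det ≠ 0 := by
      rw [det_oddNodeMatrix_eq]
      simp only [zero_add, staircaseDet_zero, mul_one]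
      exact mul_ne_zero (Finset.prod_ne_zero_iff.2 fun _ _ => by positivity)
        (Finset.prod_ne_zero_iff.2 fun _ _ => by positivity)
    rw [mul_div_mul_right _ _ hZ, det_oddNodeMatrix_eq, det_oddNodeMatrix_eq]
    simp only [zero_add, staircaseDet_zero, mul_one]
    have hx : ((l + k : ℕ) : ℚ) = (r : ℚ) + 1 := by rw [← hk]; push_cast; ring
    have hfac : (∏ a : Fin l, ((μ.rowLen a + (l - 1 - a + k))! : ℚ)) =
        (∏ a : Fin l, ((l - 1 - a + k)! : ℚ)) * raisingFac (r + 1) μ := by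
      rw [raisingFac_eq_prod_range _ _ hl, ← Finset.prod_mul_distrib]
      refine Finset.prod_congr rfl fun a _ => (factorial_mul_prod_range _ _ _ _ ?_).symm
      have : l + k = (l - 1 - a + k) + a + 1 := by omega
      rw [← hx, this]
      push_cast
      ring
    rw [hfac, hx]
    have hF : (∏ a : Fin l, ((l - 1 - a + k)! : ℚ)) ≠ 0 :=
      Finset.prod_ne_zero_iff.2 fun _ _ => by positivity
    have h2 : (∏ b : Fin l, (2 : ℚ) ^ (l - 1 - b + k : ℕ)) ≠ 0 :=
      Finset.prod_ne_zero_iff.2 fun _ _ => by positivity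
    field_simp
  · -- If `μ` has more than `r + 1` rows, both sides vanish: `((r + 1) ↾ μ)` has the factor of the
    -- cell `(r + 1, 0)`, and the last row of the numerator consists of falling factorials
    -- `(0)_k` with `k > 0`.
    have hcell : (r + 1, 0) ∈ μ.cells :=
      (YoungDiagram.mem_cells _).2 (YoungDiagram.mem_iff_lt_colLen.2 (by omega))
    have hR : raisingFac (r + 1) μ = 0 := Finset.prod_eq_zero hcell (by push_cast; ring)
    rw [hR, zero_mul, max_eq_right h.le, shiftedSchur]
    obtain ⟨n, rfl⟩ : ∃ n, l = n + 1 := ⟨l - 1, by omega⟩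
    rw [Matrix.det_eq_zero_of_row_eq_zero (Fin.last n), zero_div]
    intro j
    have hpos : 0 < μ.rowLen (Fin.rev j) := by
      rw [← YoungDiagram.mem_iff_lt_rowLen, YoungDiagram.mem_iff_lt_colLen, hl]
      exact (Fin.rev j).isLt
    have hst : staircase r (n + 1) (Fin.last n) = 0 := by
      simp only [staircase, Fin.val_last]
      rw [Nat.sub_eq_zero_of_le (by omega), Nat.cast_zero]
    have hnode : (0 : ℚ) + ((n + 1 : ℕ) : ℚ) - 1 - ((Fin.last n : Fin (n + 1)) : ℕ) =
        ((0 : ℕ) : ℚ) := by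
      rw [Fin.val_last]
      push_cast
      ring
    rw [Matrix.of_apply, hst, hnode, fallingFac_natCast, Nat.descFactorial_of_lt (by omega),
      Nat.cast_zero]

/-! ### Evaluation by Laplace expansion -/

/-- The Laplace expansion of `staircaseDet` along the first column. The matrix is given by the
list `L` of the numbers `v_a`; deleting a row is deleting an entry of `L`, and deleting the first
column is replacing `x` by `x - 1`. The test `n ≤ v_a` skips the zero entries. -/
noncomputable def laplaceDet : ℕ → List ℕ → ℚ → ℚ
  | 0, _, _ => 1
  | n + 1, L, x => ∑ i ∈ Finset.range (n + 1),
      if n ≤ L.getD i 0 then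
        (-1) ^ i * halfBinomial (x - 1) (L.getD i 0 - n) * laplaceDet n (L.eraseIdx i) (x - 1)
      else 0

theorem eraseIdx_ofFn {α : Type*} {n : ℕ} (v : Fin (n + 1) → α) (i : Fin (n + 1)) :
    (List.ofFn v).eraseIdx i = List.ofFn (v ∘ i.succAbove) := by
  refine List.ext_getElem
    (by simp [List.length_eraseIdx, Nat.lt_succ_iff.1 i.isLt]) fun j h1 h2 => ?_
  rw [List.length_ofFn] at h2
  rw [List.getElem_eraseIdx]
  split_ifs with h
  · rw [List.getElem_ofFn, List.getElem_ofFn, Function.comp_apply,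
      Fin.succAbove_of_castSucc_lt _ _ h]
    rfl
  · rw [List.getElem_ofFn, List.getElem_ofFn, Function.comp_apply,
      Fin.succAbove_of_le_castSucc _ _ (not_lt.1 h)]
    rfl

theorem staircaseDet_eq_laplaceDet {n : ℕ} (v : Fin n → ℕ) (x : ℚ) :
    staircaseDet v x = laplaceDet n (List.ofFn v) x := by
  induction n generalizing x with
  | zero => simp [staircaseDet, laplaceDet]
  | succ n ih =>
    rw [staircaseDet, Matrix.det_succ_column_zero, laplaceDet,
      ← Fin.sum_univ_eq_sum_range fun i => if n ≤ (List.ofFn v).getD i 0 then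
        (-1) ^ i * halfBinomial (x - 1) ((List.ofFn v).getD i 0 - n) *
          laplaceDet n ((List.ofFn v).eraseIdx i) (x - 1) else 0]
    refine Finset.sum_congr rfl fun i _ => ?_
    have hi : (List.ofFn v).getD i 0 = v i := by
      rw [List.getD_eq_getElem _ _ (by rw [List.length_ofFn]; exact i.isLt), List.getElem_ofFn]
    rw [hi, ← zero_mul (laplaceDet n ((List.ofFn v).eraseIdx i) (x - 1)), ← ite_mul,
      ← mul_zero ((-1 : ℚ) ^ (i : ℕ)), ← mul_ite, eraseIdx_ofFn, ← ih, staircaseDet]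
    congr 2
    · simp [staircaseEntry]
    · ext a b
      simp only [Matrix.submatrix_apply, Matrix.of_apply, Fin.val_succ, Function.comp_apply]
      congr 1
      · push_cast; ring
      · omega

/-- The numbers `w_a + ℓ - 1 - a` attached to a list `w` of length `ℓ`. -/
def betaNumbers : List ℕ → List ℕ
  | [] => []
  | a :: w => (a + w.length) :: betaNumbers w

theorem ofFn_betaNumbers (w : List ℕ) :
    List.ofFn (fun a : Fin w.length => w[a] + (w.length - 1 - a)) = betaNumbers w := by
  induction w with
  | nil => rfl
  | cons a w ih =>
    rw [betaNumbers, ← ih, List.ofFn_succ]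
    simp only [Fin.getElem_fin, Fin.val_zero, Fin.val_succ, List.getElem_cons_zero,
      List.getElem_cons_succ, List.length_cons, List.cons.injEq]
    refine ⟨by omega, ?_⟩
    congr 1
    ext i
    omega

theorem shiftedSchurStaircase_ofRowLens {w : List ℕ} (hw : w.SortedGE) (hpos : ∀ x ∈ w, 0 < x)
    (r : ℕ) :
    shiftedSchurStaircase (YoungDiagram.ofRowLens w hw) r =
      raisingFac (r + 1) (YoungDiagram.ofRowLens w hw) *
        laplaceDet w.length (betaNumbers w) (r + 1) := by
  rw [shiftedSchurStaircase_eq _ r (l := w.length), staircaseDet_eq_laplaceDet, ← ofFn_betaNumbers]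
  · simp only [YoungDiagram.rowLen_ofRowLens]
  · rw [← YoungDiagram.length_rowLens, YoungDiagram.rowLens_length_ofRowLens hpos]

/-- As a function of `x`, the polynomial with value `F_w(r)` at `x = r + 1`. -/
noncomputable def staircaseValue (w : List ℕ) (x : ℚ) : ℚ :=
  contentProd x w * laplaceDet w.length (betaNumbers w) x

/-- The summand `F_λ(r) f^λ / (a ↾ λ)` for `λ = w` and `x = r + 1`. -/
noncomputable def staircaseTerm (a x : ℚ) (w : List ℕ) : ℚ :=
  staircaseValue w x * (standardTableauxCount w : ℚ) / contentProd a w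

/-- `F_{g,r,d}(m)` as a sum over an explicit list of partitions, in terms of functions that can be
evaluated on each of them. -/
theorem smrcF_eq (g r d m : ℕ) :
    smrcF g r d m = (2 : ℚ) ^ (2 * smrcN g r d - m) /
      (((smrcN g r d - m).toNat ! : ℚ) * (m ! : ℚ)) *
        ((partitionLists m m m).map (staircaseTerm (smrcA g r d) (r + 1))).sum := by
  rw [smrcF, ← sum_partition_eq_sum_partitionLists]
  congr 1
  refine Finset.sum_congr rfl fun p _ => ?_
  have hpos : ∀ x ∈ p.parts.sort (· ≥ ·), 0 < x := fun x hx =>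
    p.parts_pos ((Multiset.mem_sort (r := (· ≥ ·))).1 hx)
  rw [partitionDiagram, shiftedSchurStaircase_ofRowLens _ hpos, numStandardTableaux_ofRowLens,
    raisingFac_ofRowLens, raisingFac_ofRowLens, staircaseTerm, staircaseValue]

/-! ### The values `F_λ(r)` for partitions of size at most 7 -/

/-!
As functions of `x = r + 1` they are polynomials in `B = x (x + 1) / 2`, the same for a partition
and its conjugate. In the calls of `simp`, the arrows make the Laplace expansion open each sum
before its terms are visited, so that the minors of zero entries are never expanded.
-/

set_option linter.unusedSimpArgs false

theorem staircaseValue_of_sum_eq_zero (x : ℚ) :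
    staircaseValue [] x = 1 := by
  simp [staircaseValue, contentProd, cellList, laplaceDet]

theorem staircaseValue_of_sum_eq_one {x B : ℚ} (hB : B = x * (x + 1) / 2) :
    staircaseValue [1] x = B := by
  subst hB
  simp [staircaseValue, contentProd, cellList, laplaceDet, betaNumbers, halfBinomial,
    fallingFac_succ, fallingFac_zero]
  ring

theorem staircaseValue_of_sum_eq_two {x B : ℚ} (hB : B = x * (x + 1) / 2) :
    staircaseValue [1, 1] x = B * (B - 1) / 2 ∧
    staircaseValue [2] x = B * (B - 1) / 2 := by
  subst hB
  refine ⟨?_, ?_⟩ <;>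
  · simp only [staircaseValue, contentProd, cellList, List.range_succ, List.range_zero,
      List.nil_append, List.cons_append, List.flatMap_cons, List.flatMap_nil, List.map_cons,
      List.map_nil, List.append_nil, List.prod_cons, List.prod_nil, Nat.cast_ofNat, Nat.cast_zero,
      Nat.cast_one, Int.reduceSub, sub_zero, sub_self, Int.reduceNeg, Int.cast_neg, Int.cast_one,
      Int.cast_zero, Int.cast_ofNat, zero_sub, laplaceDet, betaNumbers,
      ↓Finset.sum_range_succ, ↓Finset.sum_range_zero,
      List.getD_cons_zero, List.getD_cons_succ, List.eraseIdx_cons_zero, List.eraseIdx_cons_succ,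
      List.length_cons, List.length_nil, Nat.reduceAdd, Nat.reduceLeDiff, ↓reduceIte, zero_add,
      add_zero, Nat.reduceSub, halfBinomial, fallingFac_succ, fallingFac_zero]
    ring

theorem staircaseValue_of_sum_eq_three {x B : ℚ} (hB : B = x * (x + 1) / 2) :
    staircaseValue [1, 1, 1] x = B * (B - 1) * (B - 3) / 6 ∧
    staircaseValue [3] x = B * (B - 1) * (B - 3) / 6 ∧
    staircaseValue [2, 1] x = B * (B - 1) * (2 * B - 3) / 6 := by
  subst hB
  refine ⟨?_, ?_, ?_⟩ <;>
  · simp only [staircaseValue, contentProd, cellList, List.range_succ, List.range_zero,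
      List.nil_append, List.cons_append, List.flatMap_cons, List.flatMap_nil, List.map_cons,
      List.map_nil, List.append_nil, List.prod_cons, List.prod_nil, Nat.cast_ofNat, Nat.cast_zero,
      Nat.cast_one, Int.reduceSub, sub_zero, sub_self, Int.reduceNeg, Int.cast_neg, Int.cast_one,
      Int.cast_zero, Int.cast_ofNat, zero_sub, laplaceDet, betaNumbers,
      ↓Finset.sum_range_succ, ↓Finset.sum_range_zero,
      List.getD_cons_zero, List.getD_cons_succ, List.eraseIdx_cons_zero, List.eraseIdx_cons_succ,
      List.length_cons, List.length_nil, Nat.reduceAdd, Nat.reduceLeDiff, ↓reduceIte, zero_add,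
      add_zero, Nat.reduceSub, halfBinomial, fallingFac_succ, fallingFac_zero]
    ring

theorem staircaseValue_of_sum_eq_four {x B : ℚ} (hB : B = x * (x + 1) / 2) :
    staircaseValue [1, 1, 1, 1] x = B * (B - 1) * (B - 3) * (B - 6) / 24 ∧
    staircaseValue [4] x = B * (B - 1) * (B - 3) * (B - 6) / 24 ∧
    staircaseValue [2, 1, 1] x = B * (B - 1) * (B - 2) * (B - 3) / 8 ∧
    staircaseValue [3, 1] x = B * (B - 1) * (B - 2) * (B - 3) / 8 ∧
    staircaseValue [2, 2] x = B * B * (B - 1) * (B - 3) / 12 := by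
  subst hB
  refine ⟨?_, ?_, ?_, ?_, ?_⟩ <;>
  · simp only [staircaseValue, contentProd, cellList, List.range_succ, List.range_zero,
      List.nil_append, List.cons_append, List.flatMap_cons, List.flatMap_nil, List.map_cons,
      List.map_nil, List.append_nil, List.prod_cons, List.prod_nil, Nat.cast_ofNat, Nat.cast_zero,
      Nat.cast_one, Int.reduceSub, sub_zero, sub_self, Int.reduceNeg, Int.cast_neg, Int.cast_one,
      Int.cast_zero, Int.cast_ofNat, zero_sub, laplaceDet, betaNumbers,
      ↓Finset.sum_range_succ, ↓Finset.sum_range_zero,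
      List.getD_cons_zero, List.getD_cons_succ, List.eraseIdx_cons_zero, List.eraseIdx_cons_succ,
      List.length_cons, List.length_nil, Nat.reduceAdd, Nat.reduceLeDiff, ↓reduceIte, zero_add,
      add_zero, Nat.reduceSub, halfBinomial, fallingFac_succ, fallingFac_zero]
    ring

theorem staircaseValue_of_sum_eq_five {x B : ℚ} (hB : B = x * (x + 1) / 2) :
    staircaseValue [1, 1, 1, 1, 1] x = B * (B - 1) * (B - 3) * (B - 6) * (B - 10) / 120 ∧
    staircaseValue [5] x = B * (B - 1) * (B - 3) * (B - 6) * (B - 10) / 120 ∧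
    staircaseValue [2, 1, 1, 1] x = B * (B - 1) * (B - 3) * (B - 6) * (2 * B - 5) / 60 ∧
    staircaseValue [4, 1] x = B * (B - 1) * (B - 3) * (B - 6) * (2 * B - 5) / 60 ∧
    staircaseValue [2, 2, 1] x = B * B * (B - 1) * (B - 3) * (B - 4) / 24 ∧
    staircaseValue [3, 2] x = B * B * (B - 1) * (B - 3) * (B - 4) / 24 ∧
    staircaseValue [3, 1, 1] x = B * (B - 1) * (B - 3) * (B ^ 2 - 6 * B + 10) / 20 := by
  subst hB
  refine ⟨?_, ?_, ?_, ?_, ?_, ?_, ?_⟩ <;>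
  · simp only [staircaseValue, contentProd, cellList, List.range_succ, List.range_zero,
      List.nil_append, List.cons_append, List.flatMap_cons, List.flatMap_nil, List.map_cons,
      List.map_nil, List.append_nil, List.prod_cons, List.prod_nil, Nat.cast_ofNat, Nat.cast_zero,
      Nat.cast_one, Int.reduceSub, sub_zero, sub_self, Int.reduceNeg, Int.cast_neg, Int.cast_one,
      Int.cast_zero, Int.cast_ofNat, zero_sub, laplaceDet, betaNumbers,
      ↓Finset.sum_range_succ, ↓Finset.sum_range_zero,
      List.getD_cons_zero, List.getD_cons_succ, List.eraseIdx_cons_zero, List.eraseIdx_cons_succ,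
      List.length_cons, List.length_nil, Nat.reduceAdd, Nat.reduceLeDiff, ↓reduceIte, zero_add,
      add_zero, Nat.reduceSub, halfBinomial, fallingFac_succ, fallingFac_zero]
    ring

theorem staircaseValue_of_sum_eq_six {x B : ℚ} (hB : B = x * (x + 1) / 2) :
    staircaseValue [1, 1, 1, 1, 1, 1] x =
      B * (B - 1) * (B - 3) * (B - 6) * (B - 10) * (B - 15) / 720 ∧
    staircaseValue [6] x = B * (B - 1) * (B - 3) * (B - 6) * (B - 10) * (B - 15) / 720 ∧
    staircaseValue [2, 1, 1, 1, 1] x = B * (B - 1) * (B - 3) * (B - 3) * (B - 6) * (B - 10) / 144 ∧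
    staircaseValue [5, 1] x = B * (B - 1) * (B - 3) * (B - 3) * (B - 6) * (B - 10) / 144 ∧
    staircaseValue [2, 2, 1, 1] x = B * B * (B - 1) * (B - 3) * (B - 5) * (B - 6) / 80 ∧
    staircaseValue [4, 2] x = B * B * (B - 1) * (B - 3) * (B - 5) * (B - 6) / 80 ∧
    staircaseValue [2, 2, 2] x = B * B * (B - 1) * (B - 1) * (B - 3) * (B - 6) / 144 ∧
    staircaseValue [3, 3] x = B * B * (B - 1) * (B - 1) * (B - 3) * (B - 6) / 144 ∧
    staircaseValue [3, 1, 1, 1] x = B * (B - 1) * (B - 3) * (B - 6) * (B ^ 2 - 7 * B + 15) / 72 ∧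
    staircaseValue [4, 1, 1] x = B * (B - 1) * (B - 3) * (B - 6) * (B ^ 2 - 7 * B + 15) / 72 ∧
    staircaseValue [3, 2, 1] x = B * B * (B - 1) * (B - 3) * (4 * B ^ 2 - 34 * B + 75) / 180 := by
  subst hB
  refine ⟨?_, ?_, ?_, ?_, ?_, ?_, ?_, ?_, ?_, ?_, ?_⟩ <;>
  · simp only [staircaseValue, contentProd, cellList, List.range_succ, List.range_zero,
      List.nil_append, List.cons_append, List.flatMap_cons, List.flatMap_nil, List.map_cons,
      List.map_nil, List.append_nil, List.prod_cons, List.prod_nil, Nat.cast_ofNat, Nat.cast_zero,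
      Nat.cast_one, Int.reduceSub, sub_zero, sub_self, Int.reduceNeg, Int.cast_neg, Int.cast_one,
      Int.cast_zero, Int.cast_ofNat, zero_sub, laplaceDet, betaNumbers,
      ↓Finset.sum_range_succ, ↓Finset.sum_range_zero,
      List.getD_cons_zero, List.getD_cons_succ, List.eraseIdx_cons_zero, List.eraseIdx_cons_succ,
      List.length_cons, List.length_nil, Nat.reduceAdd, Nat.reduceLeDiff, ↓reduceIte, zero_add,
      add_zero, Nat.reduceSub, halfBinomial, fallingFac_succ, fallingFac_zero]
    ring

theorem staircaseValue_of_sum_eq_seven {x B : ℚ} (hB : B = x * (x + 1) / 2) :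
    staircaseValue [1, 1, 1, 1, 1, 1, 1] x =
      B * (B - 1) * (B - 3) * (B - 6) * (B - 10) * (B - 15) * (B - 21) / 5040 ∧
    staircaseValue [7] x = B * (B - 1) * (B - 3) * (B - 6) * (B - 10) * (B - 15) * (B - 21) / 5040 ∧
    staircaseValue [2, 1, 1, 1, 1, 1] x =
      B * (B - 1) * (B - 3) * (B - 6) * (B - 10) * (B - 15) * (2 * B - 7) / 1680 ∧
    staircaseValue [6, 1] x =
      B * (B - 1) * (B - 3) * (B - 6) * (B - 10) * (B - 15) * (2 * B - 7) / 1680 ∧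
    staircaseValue [2, 2, 1, 1, 1] x =
      B * B * (B - 1) * (B - 3) * (B - 6) * (B - 6) * (B - 10) / 360 ∧
    staircaseValue [5, 2] x = B * B * (B - 1) * (B - 3) * (B - 6) * (B - 6) * (B - 10) / 360 ∧
    staircaseValue [2, 2, 2, 1] x =
      B * B * (B - 1) * (B - 1) * (B - 3) * (B - 6) * (2 * B - 15) / 720 ∧
    staircaseValue [4, 3] x = B * B * (B - 1) * (B - 1) * (B - 3) * (B - 6) * (2 * B - 15) / 720 ∧
    staircaseValue [3, 1, 1, 1, 1] x =
      B * (B - 1) * (B - 3) * (B - 6) * (B - 10) * (B ^ 2 - 8 * B + 21) / 336 ∧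
    staircaseValue [5, 1, 1] x =
      B * (B - 1) * (B - 3) * (B - 6) * (B - 10) * (B ^ 2 - 8 * B + 21) / 336 ∧
    staircaseValue [3, 2, 1, 1] x =
      B * B * (B - 1) * (B - 3) * (B - 6) * (B ^ 2 - 10 * B + 27) / 144 ∧
    staircaseValue [4, 2, 1] x = B * B * (B - 1) * (B - 3) * (B - 6) * (B ^ 2 - 10 * B + 27) / 144 ∧
    staircaseValue [3, 2, 2] x = B * B * (B - 1) * (B - 1) * (B - 3) * (B - 5) * (B - 6) / 240 ∧
    staircaseValue [3, 3, 1] x = B * B * (B - 1) * (B - 1) * (B - 3) * (B - 5) * (B - 6) / 240 ∧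
    staircaseValue [4, 1, 1, 1] x =
      B * (B - 1) * (B - 3) * (B - 6) * (2 * B ^ 3 - 29 * B ^ 2 + 153 * B - 315) / 504 := by
  subst hB
  refine ⟨?_, ?_, ?_, ?_, ?_, ?_, ?_, ?_, ?_, ?_, ?_, ?_, ?_, ?_, ?_⟩ <;>
  · simp only [staircaseValue, contentProd, cellList, List.range_succ, List.range_zero,
      List.nil_append, List.cons_append, List.flatMap_cons, List.flatMap_nil, List.map_cons,
      List.map_nil, List.append_nil, List.prod_cons, List.prod_nil, Nat.cast_ofNat, Nat.cast_zero,
      Nat.cast_one, Int.reduceSub, sub_zero, sub_self, Int.reduceNeg, Int.cast_neg, Int.cast_one,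
      Int.cast_zero, Int.cast_ofNat, zero_sub, laplaceDet, betaNumbers,
      ↓Finset.sum_range_succ, ↓Finset.sum_range_zero,
      List.getD_cons_zero, List.getD_cons_succ, List.eraseIdx_cons_zero, List.eraseIdx_cons_succ,
      List.length_cons, List.length_nil, Nat.reduceAdd, Nat.reduceLeDiff, ↓reduceIte, zero_add,
      add_zero, Nat.reduceSub, halfBinomial, fallingFac_succ, fallingFac_zero]
    ring

/-! ### The weighted sums over all partitions of a given size -/

theorem add_ne_zero_of_lt_abs {a c : ℚ} (hc : 0 ≤ c) (h : c < |a|) : a + c ≠ 0 := fun h0 => by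
  rw [eq_neg_of_add_eq_zero_left h0, abs_neg, abs_of_nonneg hc] at h
  exact lt_irrefl _ h

theorem sub_ne_zero_of_lt_abs {a c : ℚ} (hc : 0 ≤ c) (h : c < |a|) : a - c ≠ 0 := fun h0 => by
  rw [sub_eq_zero.1 h0, abs_of_nonneg hc] at h
  exact lt_irrefl _ h

theorem sum_staircaseTerm_zero (A x : ℚ) :
    ((partitionLists 0 0 0).map (staircaseTerm A x)).sum = 1 := by
  have h0 := staircaseValue_of_sum_eq_zero x
  have c0 : standardTableauxCount [] = 1 := by decide
  simp [partitionLists, staircaseTerm, h0, c0, contentProd, cellList]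

theorem sum_staircaseTerm_one {A x B : ℚ} (hB : B = x * (x + 1) / 2) :
    ((partitionLists 1 1 1).map (staircaseTerm A x)).sum = B / A := by
  have hl : partitionLists 1 1 1 = [[1]] := by decide
  have h0 := staircaseValue_of_sum_eq_one hB
  have c0 : standardTableauxCount [1] = 1 := by decide
  simp [hl, staircaseTerm, h0, c0, contentProd, cellList]

theorem sum_staircaseTerm_two {A x B : ℚ} (hB : B = x * (x + 1) / 2) (hA : 2 ≤ |A|) :
    ((partitionLists 2 2 2).map (staircaseTerm A x)).sum =
      fallingFac B 2 * A / fallingFac (A + 1) 3 := by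
  have hl : partitionLists 2 2 2 = [[1, 1], [2]] := by
    decide +kernel
  obtain ⟨h0, h1⟩ := staircaseValue_of_sum_eq_two hB
  obtain ⟨c0, c1⟩ :
      standardTableauxCount [1, 1] = 1 ∧
      standardTableauxCount [2] = 1 := by
    decide +kernel
  have hA0 : A ≠ 0 := by
    rintro rfl
    norm_num at hA
  have hp1 : A + 1 ≠ 0 := add_ne_zero_of_lt_abs (by norm_num) (by linarith)
  have hm1 : A - 1 ≠ 0 := sub_ne_zero_of_lt_abs (by norm_num) (by linarith)
  have hD : fallingFac (A + 1) 3 =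
      A * ((A + 1) * (A - 1)) := by
    simp only [fallingFac_succ, fallingFac_zero]
    push_cast
    ring
  simp only [hl, List.map_cons, List.map_nil, List.sum_cons, List.sum_nil, staircaseTerm, hD,
    h0, h1,
    c0, c1]
  simp only [contentProd, cellList, List.range_succ, List.range_zero, List.nil_append,
    List.cons_append, List.flatMap_cons, List.flatMap_nil, List.map_cons, List.map_nil,
    List.append_nil, List.prod_cons, List.prod_nil, List.getD_cons_zero, List.getD_cons_succ,
    List.length_cons, List.length_nil, Nat.cast_ofNat, Nat.cast_zero, Nat.cast_one, Nat.reduceAdd,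
    Int.reduceSub, sub_zero, sub_self, zero_sub, Int.reduceNeg, Int.cast_neg, Int.cast_one,
    Int.cast_zero, Int.cast_ofNat, zero_add, add_zero, mul_one, ← sub_eq_add_neg, fallingFac_succ,
    fallingFac_zero, one_mul]
  field_simp
  ring

theorem sum_staircaseTerm_three {A x B : ℚ} (hB : B = x * (x + 1) / 2) (hA : 3 ≤ |A|) :
    ((partitionLists 3 3 3).map (staircaseTerm A x)).sum =
      (fallingFac B 3 * (A ^ 2 - 2) - 2 * fallingFac B 2) / fallingFac (A + 2) 5 := by
  have hl : partitionLists 3 3 3 = [[1, 1, 1], [2, 1], [3]] := by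
    decide +kernel
  obtain ⟨h0, h1, h2⟩ := staircaseValue_of_sum_eq_three hB
  obtain ⟨c0, c1, c2⟩ :
      standardTableauxCount [1, 1, 1] = 1 ∧
      standardTableauxCount [2, 1] = 2 ∧
      standardTableauxCount [3] = 1 := by
    decide +kernel
  have hA0 : A ≠ 0 := by
    rintro rfl
    norm_num at hA
  have hp1 : A + 1 ≠ 0 := add_ne_zero_of_lt_abs (by norm_num) (by linarith)
  have hm1 : A - 1 ≠ 0 := sub_ne_zero_of_lt_abs (by norm_num) (by linarith)
  have hp2 : A + 2 ≠ 0 := add_ne_zero_of_lt_abs (by norm_num) (by linarith)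
  have hm2 : A - 2 ≠ 0 := sub_ne_zero_of_lt_abs (by norm_num) (by linarith)
  have hD : fallingFac (A + 2) 5 =
      A * ((A + 1) * (A - 1)) * ((A + 2) * (A - 2)) := by
    simp only [fallingFac_succ, fallingFac_zero]
    push_cast
    ring
  simp only [hl, List.map_cons, List.map_nil, List.sum_cons, List.sum_nil, staircaseTerm, hD,
    h0, h1, h2,
    c0, c1, c2]
  simp only [contentProd, cellList, List.range_succ, List.range_zero, List.nil_append,
    List.cons_append, List.flatMap_cons, List.flatMap_nil, List.map_cons, List.map_nil,
    List.append_nil, List.prod_cons, List.prod_nil, List.getD_cons_zero, List.getD_cons_succ,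
    List.length_cons, List.length_nil, Nat.cast_ofNat, Nat.cast_zero, Nat.cast_one, Nat.reduceAdd,
    Int.reduceSub, sub_zero, sub_self, zero_sub, Int.reduceNeg, Int.cast_neg, Int.cast_one,
    Int.cast_zero, Int.cast_ofNat, zero_add, add_zero, mul_one, ← sub_eq_add_neg, fallingFac_succ,
    fallingFac_zero, one_mul]
  field_simp
  ring

theorem sum_staircaseTerm_four {A x B : ℚ} (hB : B = x * (x + 1) / 2) (hA : 4 ≤ |A|) :
    ((partitionLists 4 4 4).map (staircaseTerm A x)).sum =
      (fallingFac B 4 * (A ^ 2 - 1) * (A ^ 2 - 9) +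
        fallingFac B 2 * (B - 3) * (B - 6) * (2 * A ^ 2 - 3)) / (A * fallingFac (A + 3) 7) := by
  have hl : partitionLists 4 4 4 = [[1, 1, 1, 1], [2, 1, 1], [2, 2], [3, 1], [4]] := by
    decide +kernel
  obtain ⟨h0, h1, h2, h3, h4⟩ := staircaseValue_of_sum_eq_four hB
  obtain ⟨c0, c1, c2, c3, c4⟩ :
      standardTableauxCount [1, 1, 1, 1] = 1 ∧
      standardTableauxCount [2, 1, 1] = 3 ∧
      standardTableauxCount [2, 2] = 2 ∧
      standardTableauxCount [3, 1] = 3 ∧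
      standardTableauxCount [4] = 1 := by
    decide +kernel
  have hA0 : A ≠ 0 := by
    rintro rfl
    norm_num at hA
  have hp1 : A + 1 ≠ 0 := add_ne_zero_of_lt_abs (by norm_num) (by linarith)
  have hm1 : A - 1 ≠ 0 := sub_ne_zero_of_lt_abs (by norm_num) (by linarith)
  have hp2 : A + 2 ≠ 0 := add_ne_zero_of_lt_abs (by norm_num) (by linarith)
  have hm2 : A - 2 ≠ 0 := sub_ne_zero_of_lt_abs (by norm_num) (by linarith)
  have hp3 : A + 3 ≠ 0 := add_ne_zero_of_lt_abs (by norm_num) (by linarith)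
  have hm3 : A - 3 ≠ 0 := sub_ne_zero_of_lt_abs (by norm_num) (by linarith)
  have hD : fallingFac (A + 3) 7 =
      A * ((A + 1) * (A - 1)) * ((A + 2) * (A - 2)) * ((A + 3) * (A - 3)) := by
    simp only [fallingFac_succ, fallingFac_zero]
    push_cast
    ring
  simp only [hl, List.map_cons, List.map_nil, List.sum_cons, List.sum_nil, staircaseTerm, hD,
    h0, h1, h2, h3, h4,
    c0, c1, c2, c3, c4]
  simp only [contentProd, cellList, List.range_succ, List.range_zero, List.nil_append,
    List.cons_append, List.flatMap_cons, List.flatMap_nil, List.map_cons, List.map_nil,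
    List.append_nil, List.prod_cons, List.prod_nil, List.getD_cons_zero, List.getD_cons_succ,
    List.length_cons, List.length_nil, Nat.cast_ofNat, Nat.cast_zero, Nat.cast_one, Nat.reduceAdd,
    Int.reduceSub, sub_zero, sub_self, zero_sub, Int.reduceNeg, Int.cast_neg, Int.cast_one,
    Int.cast_zero, Int.cast_ofNat, zero_add, add_zero, mul_one, ← sub_eq_add_neg, fallingFac_succ,
    fallingFac_zero, one_mul]
  field_simp
  ring

theorem sum_staircaseTerm_five {A x B : ℚ} (hB : B = x * (x + 1) / 2) (hA : 5 ≤ |A|) :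
    ((partitionLists 5 5 5).map (staircaseTerm A x)).sum =
      (B * (B - 1) * (B - 3) *
        (72 + A ^ 4 * (B - 4) * (B - 2) - 20 * A ^ 2 * (B - 4) * (B - 1) +
          6 * B * (13 * B - 48))) / fallingFac (A + 4) 9 := by
  have hl : partitionLists 5 5 5 = [[1, 1, 1, 1, 1], [2, 1, 1, 1], [2, 2, 1], [3, 1, 1], [3, 2],
      [4, 1], [5]] := by
    decide +kernel
  obtain ⟨h0, h1, h2, h3, h4, h5, h6⟩ := staircaseValue_of_sum_eq_five hB
  obtain ⟨c0, c1, c2, c3, c4, c5, c6⟩ :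
      standardTableauxCount [1, 1, 1, 1, 1] = 1 ∧
      standardTableauxCount [2, 1, 1, 1] = 4 ∧
      standardTableauxCount [2, 2, 1] = 5 ∧
      standardTableauxCount [3, 1, 1] = 6 ∧
      standardTableauxCount [3, 2] = 5 ∧
      standardTableauxCount [4, 1] = 4 ∧
      standardTableauxCount [5] = 1 := by
    decide +kernel
  have hA0 : A ≠ 0 := by
    rintro rfl
    norm_num at hA
  have hp1 : A + 1 ≠ 0 := add_ne_zero_of_lt_abs (by norm_num) (by linarith)
  have hm1 : A - 1 ≠ 0 := sub_ne_zero_of_lt_abs (by norm_num) (by linarith)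
  have hp2 : A + 2 ≠ 0 := add_ne_zero_of_lt_abs (by norm_num) (by linarith)
  have hm2 : A - 2 ≠ 0 := sub_ne_zero_of_lt_abs (by norm_num) (by linarith)
  have hp3 : A + 3 ≠ 0 := add_ne_zero_of_lt_abs (by norm_num) (by linarith)
  have hm3 : A - 3 ≠ 0 := sub_ne_zero_of_lt_abs (by norm_num) (by linarith)
  have hp4 : A + 4 ≠ 0 := add_ne_zero_of_lt_abs (by norm_num) (by linarith)
  have hm4 : A - 4 ≠ 0 := sub_ne_zero_of_lt_abs (by norm_num) (by linarith)
  have hD : fallingFac (A + 4) 9 =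
      A * ((A + 1) * (A - 1)) * ((A + 2) * (A - 2)) * ((A + 3) * (A - 3)) *
        ((A + 4) * (A - 4)) := by
    simp only [fallingFac_succ, fallingFac_zero]
    push_cast
    ring
  simp only [hl, List.map_cons, List.map_nil, List.sum_cons, List.sum_nil, staircaseTerm, hD,
    h0, h1, h2, h3, h4, h5, h6,
    c0, c1, c2, c3, c4, c5, c6]
  simp only [contentProd, cellList, List.range_succ, List.range_zero, List.nil_append,
    List.cons_append, List.flatMap_cons, List.flatMap_nil, List.map_cons, List.map_nil,
    List.append_nil, List.prod_cons, List.prod_nil, List.getD_cons_zero, List.getD_cons_succ,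
    List.length_cons, List.length_nil, Nat.cast_ofNat, Nat.cast_zero, Nat.cast_one, Nat.reduceAdd,
    Int.reduceSub, sub_zero, sub_self, zero_sub, Int.reduceNeg, Int.cast_neg, Int.cast_one,
    Int.cast_zero, Int.cast_ofNat, zero_add, add_zero, mul_one, ← sub_eq_add_neg, fallingFac_succ,
    fallingFac_zero, one_mul]
  field_simp
  ring

theorem sum_staircaseTerm_six {A x B : ℚ} (hB : B = x * (x + 1) / 2) (hA : 6 ≤ |A|) :
    ((partitionLists 6 6 6).map (staircaseTerm A x)).sum =
      (B * (B - 1) * (B - 3) *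
        ((B ^ 3 - 11 * B ^ 2 + 38 * B - 40) * A ^ 8 -
          (41 * B ^ 3 - 411 * B ^ 2 + 1198 * B - 840) * A ^ 6 +
          2 * (229 * B ^ 3 - 2009 * B ^ 2 + 4636 * B - 1680) * A ^ 4 -
          2 * (629 * B ^ 3 - 4629 * B ^ 2 + 8256 * B - 1280) * A ^ 2 +
          240 * B ^ 3 - 1440 * B ^ 2 + 4800 * B)) /
      (fallingFac (A + 5) 11 * fallingFac (A + 1) 3) := by
  have hl : partitionLists 6 6 6 = [[1, 1, 1, 1, 1, 1], [2, 1, 1, 1, 1], [2, 2, 1, 1], [2, 2, 2],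
      [3, 1, 1, 1], [3, 2, 1], [3, 3], [4, 1, 1], [4, 2], [5, 1], [6]] := by
    decide +kernel
  obtain ⟨h0, h1, h2, h3, h4, h5, h6, h7, h8, h9, h10⟩ := staircaseValue_of_sum_eq_six hB
  obtain ⟨c0, c1, c2, c3, c4, c5, c6, c7, c8, c9, c10⟩ :
      standardTableauxCount [1, 1, 1, 1, 1, 1] = 1 ∧
      standardTableauxCount [2, 1, 1, 1, 1] = 5 ∧
      standardTableauxCount [2, 2, 1, 1] = 9 ∧
      standardTableauxCount [2, 2, 2] = 5 ∧
      standardTableauxCount [3, 1, 1, 1] = 10 ∧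
      standardTableauxCount [3, 2, 1] = 16 ∧
      standardTableauxCount [3, 3] = 5 ∧
      standardTableauxCount [4, 1, 1] = 10 ∧
      standardTableauxCount [4, 2] = 9 ∧
      standardTableauxCount [5, 1] = 5 ∧
      standardTableauxCount [6] = 1 := by
    decide +kernel
  have hA0 : A ≠ 0 := by
    rintro rfl
    norm_num at hA
  have hp1 : A + 1 ≠ 0 := add_ne_zero_of_lt_abs (by norm_num) (by linarith)
  have hm1 : A - 1 ≠ 0 := sub_ne_zero_of_lt_abs (by norm_num) (by linarith)
  have hp2 : A + 2 ≠ 0 := add_ne_zero_of_lt_abs (by norm_num) (by linarith)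
  have hm2 : A - 2 ≠ 0 := sub_ne_zero_of_lt_abs (by norm_num) (by linarith)
  have hp3 : A + 3 ≠ 0 := add_ne_zero_of_lt_abs (by norm_num) (by linarith)
  have hm3 : A - 3 ≠ 0 := sub_ne_zero_of_lt_abs (by norm_num) (by linarith)
  have hp4 : A + 4 ≠ 0 := add_ne_zero_of_lt_abs (by norm_num) (by linarith)
  have hm4 : A - 4 ≠ 0 := sub_ne_zero_of_lt_abs (by norm_num) (by linarith)
  have hp5 : A + 5 ≠ 0 := add_ne_zero_of_lt_abs (by norm_num) (by linarith)
  have hm5 : A - 5 ≠ 0 := sub_ne_zero_of_lt_abs (by norm_num) (by linarith)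
  have hD : fallingFac (A + 5) 11 =
      A * ((A + 1) * (A - 1)) * ((A + 2) * (A - 2)) * ((A + 3) * (A - 3)) *
        ((A + 4) * (A - 4))        * ((A + 5) * (A - 5)) := by
    simp only [fallingFac_succ, fallingFac_zero]
    push_cast
    ring
  have hD3 : fallingFac (A + 1) 3 = A * ((A + 1) * (A - 1)) := by
    simp only [fallingFac_succ, fallingFac_zero]
    push_cast
    ring
  simp only [hl, List.map_cons, List.map_nil, List.sum_cons, List.sum_nil, staircaseTerm, hD, hD3,
    h0, h1, h2, h3, h4, h5, h6, h7, h8, h9, h10,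
    c0, c1, c2, c3, c4, c5, c6, c7, c8, c9, c10]
  simp only [contentProd, cellList, List.range_succ, List.range_zero, List.nil_append,
    List.cons_append, List.flatMap_cons, List.flatMap_nil, List.map_cons, List.map_nil,
    List.append_nil, List.prod_cons, List.prod_nil, List.getD_cons_zero, List.getD_cons_succ,
    List.length_cons, List.length_nil, Nat.cast_ofNat, Nat.cast_zero, Nat.cast_one, Nat.reduceAdd,
    Int.reduceSub, sub_zero, sub_self, zero_sub, Int.reduceNeg, Int.cast_neg, Int.cast_one,
    Int.cast_zero, Int.cast_ofNat, zero_add, add_zero, mul_one, ← sub_eq_add_neg, fallingFac_succ,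
    fallingFac_zero, one_mul]
  field_simp
  ring

theorem sum_staircaseTerm_seven {A x B : ℚ} (hB : B = x * (x + 1) / 2) (hA : 7 ≤ |A|) :
    ((partitionLists 7 7 7).map (staircaseTerm A x)).sum =
      (B * (B - 1) * (B - 3) * (B - 6) *
        ((B ^ 3 - 11 * B ^ 2 + 38 * B - 40) * A ^ 8 -
          (71 * B ^ 3 - 711 * B ^ 2 + 2068 * B - 1440) * A ^ 6 +
          14 * (112 * B ^ 3 - 977 * B ^ 2 + 2233 * B - 840) * A ^ 4 -
          2 * (5699 * B ^ 3 - 40149 * B ^ 2 + 67266 * B - 9680) * A ^ 2 +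
          15780 * B ^ 3 - 73200 * B ^ 2 + 105300 * B - 9000)) /
      (fallingFac (A + 6) 13 * (A ^ 2 - 1)) := by
  have hl : partitionLists 7 7 7 = [[1, 1, 1, 1, 1, 1, 1], [2, 1, 1, 1, 1, 1], [2, 2, 1, 1, 1],
      [2, 2, 2, 1], [3, 1, 1, 1, 1], [3, 2, 1, 1], [3, 2, 2], [3, 3, 1], [4, 1, 1, 1], [4, 2, 1],
      [4, 3], [5, 1, 1], [5, 2], [6, 1], [7]] := by
    decide +kernel
  obtain ⟨h0, h1, h2, h3, h4, h5, h6, h7, h8, h9, h10, h11,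
    h12, h13, h14⟩ := staircaseValue_of_sum_eq_seven hB
  obtain ⟨c0, c1, c2, c3, c4, c5, c6, c7, c8, c9, c10, c11, c12, c13, c14⟩ :
      standardTableauxCount [1, 1, 1, 1, 1, 1, 1] = 1 ∧
      standardTableauxCount [2, 1, 1, 1, 1, 1] = 6 ∧
      standardTableauxCount [2, 2, 1, 1, 1] = 14 ∧
      standardTableauxCount [2, 2, 2, 1] = 14 ∧
      standardTableauxCount [3, 1, 1, 1, 1] = 15 ∧
      standardTableauxCount [3, 2, 1, 1] = 35 ∧
      standardTableauxCount [3, 2, 2] = 21 ∧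
      standardTableauxCount [3, 3, 1] = 21 ∧
      standardTableauxCount [4, 1, 1, 1] = 20 ∧
      standardTableauxCount [4, 2, 1] = 35 ∧
      standardTableauxCount [4, 3] = 14 ∧
      standardTableauxCount [5, 1, 1] = 15 ∧
      standardTableauxCount [5, 2] = 14 ∧
      standardTableauxCount [6, 1] = 6 ∧
      standardTableauxCount [7] = 1 := by
    decide +kernel
  have hA0 : A ≠ 0 := by
    rintro rfl
    norm_num at hA
  have hp1 : A + 1 ≠ 0 := add_ne_zero_of_lt_abs (by norm_num) (by linarith)
  have hm1 : A - 1 ≠ 0 := sub_ne_zero_of_lt_abs (by norm_num) (by linarith)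
  have hp2 : A + 2 ≠ 0 := add_ne_zero_of_lt_abs (by norm_num) (by linarith)
  have hm2 : A - 2 ≠ 0 := sub_ne_zero_of_lt_abs (by norm_num) (by linarith)
  have hp3 : A + 3 ≠ 0 := add_ne_zero_of_lt_abs (by norm_num) (by linarith)
  have hm3 : A - 3 ≠ 0 := sub_ne_zero_of_lt_abs (by norm_num) (by linarith)
  have hp4 : A + 4 ≠ 0 := add_ne_zero_of_lt_abs (by norm_num) (by linarith)
  have hm4 : A - 4 ≠ 0 := sub_ne_zero_of_lt_abs (by norm_num) (by linarith)
  have hp5 : A + 5 ≠ 0 := add_ne_zero_of_lt_abs (by norm_num) (by linarith)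
  have hm5 : A - 5 ≠ 0 := sub_ne_zero_of_lt_abs (by norm_num) (by linarith)
  have hp6 : A + 6 ≠ 0 := add_ne_zero_of_lt_abs (by norm_num) (by linarith)
  have hm6 : A - 6 ≠ 0 := sub_ne_zero_of_lt_abs (by norm_num) (by linarith)
  have hD : fallingFac (A + 6) 13 =
      A * ((A + 1) * (A - 1)) * ((A + 2) * (A - 2)) * ((A + 3) * (A - 3)) *
        ((A + 4) * (A - 4))        * ((A + 5) * (A - 5)) * ((A + 6) * (A - 6)) := by
    simp only [fallingFac_succ, fallingFac_zero]
    push_cast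
    ring
  have hS : A ^ 2 - 1 = (A + 1) * (A - 1) := by ring
  simp only [hl, List.map_cons, List.map_nil, List.sum_cons, List.sum_nil, staircaseTerm, hD, hS,
    h0, h1, h2, h3, h4, h5, h6, h7, h8, h9, h10, h11,
    h12, h13, h14,
    c0, c1, c2, c3, c4, c5, c6, c7, c8, c9, c10, c11, c12, c13, c14]
  simp only [contentProd, cellList, List.range_succ, List.range_zero, List.nil_append,
    List.cons_append, List.flatMap_cons, List.flatMap_nil, List.map_cons, List.map_nil,
    List.append_nil, List.prod_cons, List.prod_nil, List.getD_cons_zero, List.getD_cons_succ,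
    List.length_cons, List.length_nil, Nat.cast_ofNat, Nat.cast_zero, Nat.cast_one, Nat.reduceAdd,
    Int.reduceSub, sub_zero, sub_self, zero_sub, Int.reduceNeg, Int.cast_neg, Int.cast_one,
    Int.cast_zero, Int.cast_ofNat, zero_add, add_zero, mul_one, ← sub_eq_add_neg, fallingFac_succ,
    fallingFac_zero, one_mul]
  field_simp
  ring

/-! ### The formulas -/

theorem div_mul_div_eq (p f q n d : ℚ) : p / (f * q) * (n / d) = p / (d * f * q) * n := by
  ring

theorem mainTheorem9 (g r d : ℕ) (hg : 0 < g) (hr : 0 < r) (hd : 0 < d)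
    (N : ℤ) (hN : N = smrcN g r d) (A B : ℚ) (hA : A = (smrcA g r d : ℚ))
    (hB : B = ((r + 2).choose 2 : ℚ)) :
    (0 ≤ N →
      smrcF g r d 0 = 2 ^ (2 * N) / (N.toNat ! : ℚ)) ∧
    (1 ≤ N → 1 ≤ |A| →
      smrcF g r d 1 = 2 ^ (2 * N - 1) * B / (A * ((N - 1).toNat ! : ℚ) * (1 ! : ℚ))) ∧
    (2 ≤ N → 2 ≤ |A| →
      smrcF g r d 2 =
        2 ^ (2 * N - 2) * fallingFac B 2 * A /
          (fallingFac (A + 1) 3 * ((N - 2).toNat ! : ℚ) * (2 ! : ℚ))) ∧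
    (3 ≤ N → 3 ≤ |A| →
      smrcF g r d 3 =
        2 ^ (2 * N - 3) / (fallingFac (A + 2) 5 * ((N - 3).toNat ! : ℚ) * (3 ! : ℚ)) *
          (fallingFac B 3 * (A ^ 2 - 2) - 2 * fallingFac B 2)) ∧
    (4 ≤ N → 4 ≤ |A| →
      smrcF g r d 4 =
        2 ^ (2 * N - 4) / (A * fallingFac (A + 3) 7 * ((N - 4).toNat ! : ℚ) * (4 ! : ℚ)) *
          (fallingFac B 4 * (A ^ 2 - 1) * (A ^ 2 - 9) +
            fallingFac B 2 * (B - 3) * (B - 6) * (2 * A ^ 2 - 3))) ∧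
    (5 ≤ N → 5 ≤ |A| →
      smrcF g r d 5 =
        2 ^ (2 * N - 5) / (fallingFac (A + 4) 9 * ((N - 5).toNat ! : ℚ) * (5 ! : ℚ)) *
          (B * (B - 1) * (B - 3) *
            (72 + A ^ 4 * (B - 4) * (B - 2) - 20 * A ^ 2 * (B - 4) * (B - 1) +
              6 * B * (13 * B - 48)))) ∧
    (6 ≤ N → 6 ≤ |A| →
      smrcF g r d 6 =
        2 ^ (2 * N - 6) /
            (fallingFac (A + 5) 11 * fallingFac (A + 1) 3 * ((N - 6).toNat ! : ℚ) * (6 ! : ℚ)) *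
          (B * (B - 1) * (B - 3) *
            ((B ^ 3 - 11 * B ^ 2 + 38 * B - 40) * A ^ 8 -
              (41 * B ^ 3 - 411 * B ^ 2 + 1198 * B - 840) * A ^ 6 +
              2 * (229 * B ^ 3 - 2009 * B ^ 2 + 4636 * B - 1680) * A ^ 4 -
              2 * (629 * B ^ 3 - 4629 * B ^ 2 + 8256 * B - 1280) * A ^ 2 +
              240 * B ^ 3 - 1440 * B ^ 2 + 4800 * B))) ∧
    (7 ≤ N → 7 ≤ |A| →
      smrcF g r d 7 =
        2 ^ (2 * N - 7) /
            (fallingFac (A + 6) 13 * (A ^ 2 - 1) * ((N - 7).toNat ! : ℚ) * (7 ! : ℚ)) *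
          (B * (B - 1) * (B - 3) * (B - 6) *
            ((B ^ 3 - 11 * B ^ 2 + 38 * B - 40) * A ^ 8 -
              (71 * B ^ 3 - 711 * B ^ 2 + 2068 * B - 1440) * A ^ 6 +
              14 * (112 * B ^ 3 - 977 * B ^ 2 + 2233 * B - 840) * A ^ 4 -
              2 * (5699 * B ^ 3 - 40149 * B ^ 2 + 67266 * B - 9680) * A ^ 2 +
              15780 * B ^ 3 - 73200 * B ^ 2 + 105300 * B - 9000))) := by
  have hB' : B = ((r : ℚ) + 1) * ((r : ℚ) + 1 + 1) / 2 := by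
    rw [hB, Nat.cast_choose_two]
    push_cast
    ring
  refine ⟨fun _ => ?_, fun _ _ => ?_, fun _ h => ?_, fun _ h => ?_, fun _ h => ?_, fun _ h => ?_,
    fun _ h => ?_, fun _ h => ?_⟩
  · rw [smrcF_eq, ← hN, ← hA, sum_staircaseTerm_zero]
    simp
  · rw [smrcF_eq, ← hN, ← hA, sum_staircaseTerm_one hB', Nat.cast_one]
    ring
  · rw [smrcF_eq, ← hN, ← hA, sum_staircaseTerm_two hB' h, Nat.cast_ofNat]
    ring
  · rw [smrcF_eq, ← hN, ← hA, sum_staircaseTerm_three hB' h, Nat.cast_ofNat]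
    exact div_mul_div_eq ..
  · rw [smrcF_eq, ← hN, ← hA, sum_staircaseTerm_four hB' h, Nat.cast_ofNat]
    exact div_mul_div_eq ..
  · rw [smrcF_eq, ← hN, ← hA, sum_staircaseTerm_five hB' h, Nat.cast_ofNat]
    exact div_mul_div_eq ..
  · rw [smrcF_eq, ← hN, ← hA, sum_staircaseTerm_six hB' h, Nat.cast_ofNat]
    exact div_mul_div_eq ..
  · rw [smrcF_eq, ← hN, ← hA, sum_staircaseTerm_seven hB' h, Nat.cast_ofNat]
    exact div_mul_div_eq ..
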